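/- Let $k\ge 1$ and $d\ge 2$ be integers. In the online vertex-weighted $b$-matching problem with variable server capacities, a finite nonempty set $S$ of servers is known in advance, where $s\in S$ has a capacity $b_s\in\{1,2,\dots\}$ and a weight $w_s\ge 0$. Requests arrive one by one; on arrival a request reveals its set of neighboring servers and must be immediately and irrevocably either matched to one neighbor or left unmatched, where every server $s$ may be matched to at most $b_s$ requests. An edge matched at $s$ has value $w_s$, and the goal is to maximize the total value. The input graph is a $(k,d)$-graph if every server $s$ has degree at least $k\,b_s$ and every request has degree at most $d$. An algorithm is $c$-competitive if on every $(k,d)$-graph, for every order of arrival, the value of its matching is at least $c$ times the maximum value of a $b$-matching of the graph. For an integer $b\ge 1$ put $$c^*(b)=1-\frac1b\left(\sum_{i=1}^{b} i\binom{kb}{b-i}\frac{1}{(d-1)^{b-i}}\right)\left(1-\frac1d\right)^{kb},$$ and write $c^*_s=c^*(b_s)$. For a server $s$ let $V_s(l,\delta)$ ($0\le l\le b_s$, $\delta\ge l$) be given by $V_s(l,\delta)=1$ if $l=b_s$ or $\delta\ge k b_s$, and by $$b_s\Big(V_s(l+1,\delta+1)-V_s(l,\delta)+(d-1)\big(V_s(l,\delta+1)-V_s(l,\delta)\big)\Big)=\frac1{c^*_s}\qquad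 (l<b_s,\ \delta<k b_s).$$ The algorithm WeightedAssignment(VW) leaves an arriving request unmatched if it has no neighbor with remaining capacity, and otherwise matches it to a neighbor $s$ with remaining capacity that maximizes $w_s\, b_s\,\big(V_s(l_s,\delta_s+1)-V_s(l_s,\delta_s)\big)$, where $l_s$ is the number of requests matched to $s$ so far and $\delta_s$ is the number of previous requests adjacent to $s$; ties are broken arbitrarily. **Theorem.** 1. WeightedAssignment(VW) is a well-defined deterministic online algorithm and, for every rule for breaking ties, it is $\min_{s\in S}c^*_s$-competitive. 2. If $k\ge d$, then $\min_{s\in S}c^*_s=c^*_{\min}$, where $c^*_{\min}:=c^*(\min_{s\in S}b_s)$. 3. If $k\ge d$, this ratio is optimal: for every finite nonempty set $T$ of pairs (capacity, weight) with positive weights, if a deterministic online algorithm is $c$-competitive on all server sets $S$ with $\{(b_s,w_s): s\in S\}=T$, then $c\le c^*(\min\{b:(b,w)\in T\})$. -/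

import Mathlib

/-!
Online vertex-weighted `b`-matching. `S` is the finite set of servers, `b s` the capacity and `w s`
the weight of server `s`; these are known in advance. A request is given by the set of servers it is
adjacent to, and an input is the list of requests in order of arrival. Such a list is the same thing
as a bipartite graph on servers and requests together with an order on the requests.
-/

namespace OnlineBMatching

section Basic

variable {S : Type*} [Fintype S] [DecidableEq S]

/-- The degree of server `s` in the graph formed by the requests in `σ`. -/
def degree (σ : List (Finset S)) (s : S) : ℕ :=
  σ.countP (fun r => decide (s ∈ r))

/-- `(k,d)`-graphs: every server `s` has degree at least `k * b s`, and every request has degree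
at most `d`. -/
def IsKDGraph (k d : ℕ) (b : S → ℕ) (σ : List (Finset S)) : Prop :=
  (∀ s, k * b s ≤ degree σ s) ∧ ∀ r ∈ σ, r.card ≤ d

/-- The load of server `s`: the number of requests assigned to `s`. -/
def load {n : ℕ} (m : Fin n → Option S) (s : S) : ℕ :=
  (Finset.univ.filter (fun i => m i = some s)).card

/-- `m`, which assigns each request to at most one server (`none`: unmatched), is a `b`-matching:
requests are assigned along edges, and no server exceeds its capacity. -/
def IsBMatching (b : S → ℕ) (σ : List (Finset S)) (m : Fin σ.length → Option S) : Prop :=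
  (∀ i s, m i = some s → s ∈ σ.get i) ∧ ∀ s, load m s ≤ b s

/-- The weight of a matching: an edge incident to `s` is worth `w s`. -/
def value (w : S → ℝ) {n : ℕ} (m : Fin n → Option S) : ℝ :=
  ∑ i, (m i).elim 0 w

/-- The maximum weight of a `b`-matching in the graph `σ` (a maximum over a nonempty finite set,
see `isGreatest_opt`). -/
noncomputable def opt (b : S → ℕ) (w : S → ℝ) (σ : List (Finset S)) : ℝ :=
  sSup {x : ℝ | ∃ m : Fin σ.length → Option S, IsBMatching b σ m ∧ value w m = x}

theorem isGreatest_opt (b : S → ℕ) (w : S → ℝ) (σ : List (Finset S)) :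
    IsGreatest {x : ℝ | ∃ m : Fin σ.length → Option S, IsBMatching b σ m ∧ value w m = x}
      (opt b w σ) := by
  have hfin : {x : ℝ | ∃ m : Fin σ.length → Option S, IsBMatching b σ m ∧ value w m = x}.Finite :=
    (Set.toFinite {m : Fin σ.length → Option S | IsBMatching b σ m}).image (value w)
  have hne : {x : ℝ | ∃ m : Fin σ.length → Option S,
      IsBMatching b σ m ∧ value w m = x}.Nonempty :=
    ⟨_, fun _ => none, ⟨by simp, by simp [load]⟩, rfl⟩
  exact ⟨hne.csSup_mem hfin, fun x hx => le_csSup hfin.bddAbove hx⟩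

/-- The assignment produced by an online rule: `assign past r` is the decision for the request `r`
arriving after the requests `past`. Earlier decisions of a deterministic rule are determined by
`past`, so they need not be passed to it. -/
def run (assign : List (Finset S) → Finset S → Option S) (σ : List (Finset S)) :
    Fin σ.length → Option S :=
  fun i => assign (σ.take i) (σ.get i)

/-- A deterministic online algorithm for the servers `S` with capacities `b`. It may leave a request
unmatched. -/
structure OnlineAlgorithm (b : S → ℕ) where
  assign : List (Finset S) → Finset S → Option S
  isBMatching_run : ∀ σ : List (Finset S), IsBMatching b σ (run assign σ)

/-- `A` is `c`-competitive on `(k,d)`-graphs. -/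
def IsCompetitive (k d : ℕ) {b : S → ℕ} (w : S → ℝ) (A : OnlineAlgorithm b) (c : ℝ) : Prop :=
  ∀ σ : List (Finset S), IsKDGraph k d b σ → c * opt b w σ ≤ value w (run A.assign σ)

end Basic

/-- The constant `c*` for capacity `b`. -/
noncomputable def cStar (k d b : ℕ) : ℝ :=
  1 - 1 / (b : ℝ) *
    (∑ i ∈ Finset.Icc 1 b,
      (i : ℝ) * ((k * b).choose (b - i) : ℝ) * (1 / ((d : ℝ) - 1) ^ (b - i))) *
    (1 - 1 / (d : ℝ)) ^ (k * b)

/-- The function `V(l, δ)` for a server of capacity `b`: it is `1` if `l = b` or `δ ≥ k b`, and in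
the remaining cases it is determined by
`V(l+1,δ+1) - V(l,δ) + (d-1) (V(l,δ+1) - V(l,δ)) = 1 / (b c*)`, see `V_eq`. -/
noncomputable def V (k d b l δ : ℕ) : ℝ :=
  if b ≤ l ∨ k * b ≤ δ then 1
  else (V k d b (l + 1) (δ + 1) + ((d : ℝ) - 1) * V k d b l (δ + 1)
    - 1 / ((b : ℝ) * cStar k d b)) / (d : ℝ)
termination_by k * b - δ
decreasing_by all_goals omega

theorem V_full (k d b l δ : ℕ) (h : b ≤ l) : V k d b l δ = 1 := by
  rw [V, if_pos (Or.inl h)]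

theorem V_of_degree (k d b l δ : ℕ) (h : k * b ≤ δ) : V k d b l δ = 1 := by
  rw [V, if_pos (Or.inr h)]

theorem V_eq (k d b l δ : ℕ) (hd : 2 ≤ d) (hl : l < b) (hδ : δ < k * b) :
    V k d b (l + 1) (δ + 1) - V k d b l δ + ((d : ℝ) - 1) * (V k d b l (δ + 1) - V k d b l δ)
      = 1 / ((b : ℝ) * cStar k d b) := by
  have hd' : (d : ℝ) ≠ 0 := by
    have : d ≠ 0 := by omega
    exact_mod_cast this
  have h : V k d b l δ = (V k d b (l + 1) (δ + 1) + ((d : ℝ) - 1) * V k d b l (δ + 1)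
      - 1 / ((b : ℝ) * cStar k d b)) / (d : ℝ) := by
    rw [V, if_neg (by omega)]
  rw [eq_div_iff hd'] at h
  linarith

section Algorithm

variable {S : Type*} [Fintype S] [DecidableEq S]

/-- The quantity `w_s b_s (V_s(l_s, δ_s + 1) - V_s(l_s, δ_s))` when the algorithm `A` has processed
the requests `past`; `l_s` and `δ_s` are the load and degree of `s` at that time. -/
noncomputable def priority (k d : ℕ) {b : S → ℕ} (w : S → ℝ) (A : OnlineAlgorithm b)
    (past : List (Finset S)) (s : S) : ℝ :=
  w s * (b s : ℝ) *
    (V k d (b s) (load (run A.assign past) s) (degree past s + 1)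
      - V k d (b s) (load (run A.assign past) s) (degree past s))

/-- The neighbours of the request `r` with remaining capacity when `A` has processed `past`. -/
def available {b : S → ℕ} (A : OnlineAlgorithm b) (past : List (Finset S)) (r : Finset S) :
    Finset S :=
  r.filter (fun s => load (run A.assign past) s < b s)

/-- `A` is the algorithm WeightedAssignment(VW), with some rule for breaking ties: a request without
available neighbour stays unmatched, any other request is assigned to an available neighbour of
maximum priority. -/
def IsWeightedAssignmentVW (k d : ℕ) {b : S → ℕ} (w : S → ℝ) (A : OnlineAlgorithm b) : Prop :=
  ∀ (past : List (Finset S)) (r : Finset S),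
    (available A past r = ∅ → A.assign past r = none) ∧
    ((available A past r).Nonempty →
      ∃ s ∈ available A past r, A.assign past r = some s ∧
        ∀ s' ∈ available A past r, priority k d w A past s' ≤ priority k d w A past s)

end Algorithm

end OnlineBMatching

/-! Everything rests on a probabilistic reading of the constants. Let X be binomial with `k * b`
trials and success probability `1 / d`. Then `b * cStar k d b` is the mean of min(b, X)
(`mul_cStar`): the expected load of a server of degree `k * b` if each of its requests picks it with
probability `1 / d`. Likewise `b * cStar k d b * (1 - V k d b l δ)` is the expected load still to be
gained from load `l` and degree `δ` (`V_eq_binE`). Hence `V` is 0 at the start; it is 1 once the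
degree reaches `k * b`, and it never decreases in `δ`.

Competitiveness is a potential argument with ∑ w_s b_s V_s. When a request goes to `s`, each of the
at most `d - 1` other neighbours raises the potential by its priority, which is at most that of `s`.
The recursion for `V` then bounds the total rise by w_s / c*_s (`potential_concat_sub_le`). On a
(k,d)-graph the potential ends at ∑ w_s b_s, an upper bound for the optimum.

The smallest capacity gives the smallest constant because `cStar` is monotone in `b`
(`cStar_le_succ`).

For optimality, Hall's theorem with `d ≤ k` makes the optimum at least ∑ w_s b_s
(`exists_saturating`). An adversary repeatedly groups servers of equal history into requests of size
`d`. At most one server per group gains load, so the loads are at best binomially distributed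
(`exists_adversary`). With many servers of the critical type, all others become negligible. -/

namespace OnlineBMatching

/-! ### Binomial expectations, by recursion on the number of trials. -/

section Binomial

/-- The expectation of `g` under the binomial distribution with `n` trials and success
probability `p`. -/
noncomputable def binE (p : ℝ) : ℕ → (ℕ → ℝ) → ℝ
  | 0, g => g 0
  | n + 1, g => p * binE p n (fun i => g (i + 1)) + (1 - p) * binE p n g

variable {p : ℝ}

theorem binE_add (n : ℕ) (f g : ℕ → ℝ) :
    binE p n (fun i => f i + g i) = binE p n f + binE p n g := by
  induction n generalizing f g with
  | zero => rfl
  | succ n ih => simp only [binE]; rw [ih f g, ih (fun i => f (i + 1)) (fun i => g (i + 1))]; ring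

theorem binE_const_mul (n : ℕ) (c : ℝ) (g : ℕ → ℝ) :
    binE p n (fun i => c * g i) = c * binE p n g := by
  induction n generalizing g with
  | zero => rfl
  | succ n ih => simp only [binE]; rw [ih g, ih (fun i => g (i + 1))]; ring

theorem binE_const (n : ℕ) (c : ℝ) : binE p n (fun _ => c) = c := by
  induction n with
  | zero => rfl
  | succ n ih => simp only [binE]; rw [ih]; ring

theorem binE_mono (h0 : 0 ≤ p) (h1 : p ≤ 1) (n : ℕ) {f g : ℕ → ℝ} (h : ∀ i, f i ≤ g i) :
    binE p n f ≤ binE p n g := by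
  induction n generalizing f g with
  | zero => exact h 0
  | succ n ih =>
    exact add_le_add (mul_le_mul_of_nonneg_left (ih fun i => h (i + 1)) h0)
      (mul_le_mul_of_nonneg_left (ih h) (sub_nonneg.2 h1))

theorem binE_pos (h0 : 0 ≤ p) (h1 : p ≤ 1) (n : ℕ) {g : ℕ → ℝ} {c : ℝ} (hc : 0 < c)
    (h : ∀ i, c ≤ g i) : 0 < binE p n g :=
  hc.trans_le ((binE_const (p := p) n c).symm.le.trans (binE_mono h0 h1 n h))

theorem binE_add_trials (m n : ℕ) (g : ℕ → ℝ) :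
    binE p (m + n) g = binE p m (fun a => binE p n (fun x => g (a + x))) := by
  induction m generalizing g with
  | zero => simp [binE]
  | succ m ih =>
    rw [Nat.add_right_comm]
    simp only [binE]
    rw [ih g, ih fun i => g (i + 1)]
    simp only [Nat.add_right_comm]

/-- Size-biasing: the `n + 1` trials contribute equally to the factor `i`, and given that one of
them succeeds the others are `n` independent trials. -/
theorem binE_mul_self (n : ℕ) (f : ℕ → ℝ) :
    binE p (n + 1) (fun i => f i * i) = (n + 1) * p * binE p n (fun i => f (i + 1)) := by
  induction n generalizing f with
  | zero => simp [binE]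
  | succ n ih =>
    have e : (fun i : ℕ => f (i + 1) * ((i + 1 : ℕ) : ℝ))
        = fun i => f (i + 1) * (i : ℝ) + f (i + 1) := by
      funext i; push_cast; ring
    rw [binE, e, binE_add, ih, ih f]
    simp only [binE]
    push_cast; ring

theorem binE_eq_sum (n : ℕ) (g : ℕ → ℝ) :
    binE p n g = ∑ i ∈ Finset.range (n + 1), (n.choose i : ℝ) * (p ^ i * (1 - p) ^ (n - i) * g i) := by
  rw [← Finset.Nat.sum_antidiagonal_eq_sum_range_succ
    (fun i j => (n.choose i : ℝ) * (p ^ i * (1 - p) ^ j * g i))]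
  induction n generalizing g with
  | zero => simp [binE]
  | succ n ih =>
    rw [Finset.sum_antidiagonal_choose_succ_mul (fun i j => p ^ i * (1 - p) ^ j * g i), binE,
      ih, ih, Finset.mul_sum, Finset.mul_sum, add_comm]
    congr 1
    · exact Finset.sum_congr rfl fun x _ => by ring
    · refine Finset.sum_congr rfl fun x hx => ?_
      rw [Nat.choose_symm_of_eq_add (Finset.HasAntidiagonal.mem_antidiagonal.1 hx).symm]
      ring

end Binomial

/-! ### The constant c* as a binomial expectation, and its monotonicity in the capacity. -/

section Constant

variable {k d b : ℕ}

theorem one_div_natCast_le_one (hd : 2 ≤ d) : 1 / (d : ℝ) ≤ 1 := by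
  have : (2 : ℝ) ≤ d := by exact_mod_cast hd
  rw [div_le_one (by linarith)]; linarith

theorem cStar_eq_one_sub_binE (hk : 1 ≤ k) (hd : 2 ≤ d) :
    cStar k d b = 1 - 1 / (b : ℝ) * binE (1 / d) (k * b) (fun i => ((b - i : ℕ) : ℝ)) := by
  have hd' : (2 : ℝ) ≤ d := by exact_mod_cast hd
  have hb : b ≤ k * b := Nat.le_mul_of_pos_left b hk
  rw [cStar, mul_assoc, binE_eq_sum, Finset.sum_mul]
  congr 2
  symm
  -- Terms with `i ≥ b` vanish by truncated subtraction; the others are reindexed by `i ↦ b - i`.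
  rw [← Finset.sum_subset (s₁ := Finset.range b)
    (fun x hx => by simp only [Finset.mem_range] at hx ⊢; omega)
    (fun x _ hx => by
      simp only [Finset.mem_range, not_lt] at hx
      simp [Nat.sub_eq_zero_of_le hx])]
  refine Finset.sum_bij' (fun i _ => b - i) (fun i _ => b - i) ?_ ?_ ?_ ?_ ?_
  · intro i hi; simp only [Finset.mem_range, Finset.mem_Icc] at hi ⊢; omega
  · intro i hi; simp only [Finset.mem_range, Finset.mem_Icc] at hi ⊢; omega
  · intro i hi; simp only [Finset.mem_range] at hi; omega
  · intro i hi; simp only [Finset.mem_Icc] at hi; omega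
  · intro i hi
    simp only [Finset.mem_range] at hi
    have hbi : b - (b - i) = i := by omega
    have hi' : i ≤ k * b := by omega
    -- With p = 1/d this turns p^i (1-p)^(n-i) into (1-p)^n / (d-1)^i, the form used in `cStar`.
    have e : (1 - 1 / (d : ℝ)) = (d - 1) * (1 / d) := by field_simp
    have h1 : ((d : ℝ) - 1) ≠ 0 := by linarith
    rw [hbi, e, ← pow_sub_mul_pow _ hi', mul_pow _ _ i]
    field_simp

/-- The truncated deficit `b - i` and `min b i` add up to `b`. -/
theorem mul_cStar (hk : 1 ≤ k) (hd : 2 ≤ d) (hb : 1 ≤ b) :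
    (b : ℝ) * cStar k d b = binE (1 / d) (k * b) (fun i => ((min b i : ℕ) : ℝ)) := by
  have hb' : (b : ℝ) ≠ 0 := by positivity
  have h := binE_add (p := 1 / d) (k * b) (fun i => ((min b i : ℕ) : ℝ))
    (fun i => ((b - i : ℕ) : ℝ))
  have e : (fun i : ℕ => ((min b i : ℕ) : ℝ) + ((b - i : ℕ) : ℝ)) = fun _ => (b : ℝ) := by
    funext i
    rw [← Nat.cast_add]
    congr 1
    omega
  rw [e, binE_const] at h
  rw [cStar_eq_one_sub_binE hk hd]
  field_simp
  linarith

theorem cStar_pos (hk : 1 ≤ k) (hd : 2 ≤ d) (hb : 1 ≤ b) : 0 < cStar k d b := by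
  have hb' : (0 : ℝ) < b := by exact_mod_cast hb
  have hd' : (0 : ℝ) < 1 / d := by positivity
  refine pos_of_mul_pos_right (a := (b : ℝ)) ?_ hb'.le
  rw [mul_cStar hk hd hb]
  obtain ⟨n, hn⟩ : ∃ n, k * b = n + 1 :=
    ⟨k * b - 1, by have := Nat.mul_pos hk hb; omega⟩
  rw [hn, binE]
  -- If the first trial succeeds, the minimum is at least 1.
  refine add_pos_of_pos_of_nonneg (mul_pos hd' ?_) (mul_nonneg ?_ ?_)
  · refine binE_pos hd'.le (one_div_natCast_le_one hd) n one_pos fun i => ?_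
    exact_mod_cast le_min hb (Nat.succ_le_succ (Nat.zero_le i))
  · exact sub_nonneg.2 (one_div_natCast_le_one hd)
  · exact (binE_const (p := 1 / (d : ℝ)) n 0).symm.le.trans
      (binE_mono hd'.le (one_div_natCast_le_one hd) n fun i => Nat.cast_nonneg _)

/-- Given the number of successes in `m + n` trials, the expected number of successes in the last
`n` trials is proportional to `n`. -/
theorem binE_mul_partial (p : ℝ) (m n : ℕ) (f : ℕ → ℝ) :
    (m + n : ℕ) * binE p m (fun a => binE p n (fun x => f (a + x) * x))
      = n * binE p (m + n) (fun x => f x * x) := by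
  cases n with
  | zero =>
    have : (fun a => binE p 0 (fun x => f (a + x) * x)) = fun _ => 0 := by
      funext a; simp [binE]
    rw [this, binE_const]; simp
  | succ n =>
    have : (fun a => binE p (n + 1) (fun x => f (a + x) * x))
        = fun a => ((n + 1) * p) * binE p n (fun x => f (a + x + 1)) := by
      funext a; rw [binE_mul_self]; rfl
    -- Size-biasing both sides leaves multiples of the same expectation over `m + n` trials.
    rw [this, binE_const_mul, ← binE_add_trials (g := fun x => f (x + 1)), ← add_assoc,
      binE_mul_self]
    push_cast; ring

/-- Split `k * (b + 1)` trials into `k` and `k * b`, let N count all successes and x those in the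
second block. On the event N ≤ b the deficit of the second block is at least b - x, and elsewhere it
is at least 0. On that event x averages b/(b+1) times N, so the bound is b/(b+1) times the mean
deficit for capacity `b + 1`. -/
theorem cStar_le_succ (hk : 1 ≤ k) (hd : 2 ≤ d) (hb : 1 ≤ b) :
    cStar k d b ≤ cStar k d (b + 1) := by
  have hp0 : (0 : ℝ) ≤ 1 / d := by positivity
  have hp1 := one_div_natCast_le_one hd
  have hb0 : (0 : ℝ) < b := by exact_mod_cast hb
  have hk0 : (0 : ℝ) < k := by exact_mod_cast hk
  rw [cStar_eq_one_sub_binE hk hd, cStar_eq_one_sub_binE hk hd]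
  have hkb : k * (b + 1) = k + k * b := by ring
  set p := 1 / (d : ℝ)
  let f : ℕ → ℝ := fun x => if x < b + 1 then 1 else 0
  have e1 : binE p (k * (b + 1)) (fun i => ((b + 1 - i : ℕ) : ℝ))
      = (b + 1) * binE p (k * (b + 1)) f - binE p (k * (b + 1)) (fun x => f x * x) := by
    rw [sub_eq_add_neg, ← binE_const_mul, ← neg_one_mul, ← binE_const_mul, ← binE_add]
    congr 1; funext i
    by_cases hi : i < b + 1
    · simp only [f, if_pos hi, Nat.cast_sub hi.le]; push_cast; ring
    · simp only [f, if_neg hi, Nat.sub_eq_zero_of_le (not_lt.1 hi)]; simp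
  have e2 := binE_mul_partial p k (k * b) f
  have e3 : b * binE p (k * (b + 1)) f
      - binE p k (fun a => binE p (k * b) (fun x => f (a + x) * x))
      ≤ binE p (k * b) (fun i => ((b - i : ℕ) : ℝ)) := by
    rw [hkb, binE_add_trials, sub_eq_add_neg, ← binE_const_mul, ← neg_one_mul, ← binE_const_mul,
      ← binE_add, ← binE_const (p := p) k (binE p (k * b) _)]
    refine binE_mono hp0 hp1 k fun a => ?_
    rw [← binE_const_mul, ← binE_const_mul, ← binE_add]
    refine binE_mono hp0 hp1 _ fun x => ?_
    by_cases hx : a + x < b + 1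
    · simp only [f, if_pos hx]
      have : (b : ℝ) ≤ ((b - x : ℕ) : ℝ) + x := by exact_mod_cast (by omega : b ≤ b - x + x)
      linarith
    · simp only [f, if_neg hx]; simp
  rw [← hkb] at e2
  push_cast at e2 ⊢
  have e4 : (b + 1) * binE p k (fun a => binE p (k * b) (fun x => f (a + x) * x))
      = b * binE p (k * (b + 1)) (fun x => f x * x) := by
    apply mul_left_cancel₀ hk0.ne'
    linarith
  rw [e1]
  have : 1 / ((b : ℝ) + 1) * ((b + 1) * binE p (k * (b + 1)) f
      - binE p (k * (b + 1)) (fun x => f x * x))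
      ≤ 1 / (b : ℝ) * binE p (k * b) (fun i => ((b - i : ℕ) : ℝ)) := by
    rw [one_div_mul_eq_div, one_div_mul_eq_div, div_le_div_iff₀ (by positivity) hb0]
    have := mul_le_mul_of_nonneg_right e3 (by positivity : (0 : ℝ) ≤ b + 1)
    linarith
  linarith

theorem cStar_mono (hk : 1 ≤ k) (hd : 2 ≤ d) {b b' : ℕ} (hb : 1 ≤ b) (h : b ≤ b') :
    cStar k d b ≤ cStar k d b' := by
  induction b', h using Nat.le_induction with
  | base => exact le_rfl
  | succ n hn ih => exact ih.trans (cStar_le_succ hk hd (hb.trans hn))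

theorem inf'_cStar (hk : 1 ≤ k) (hd : 2 ≤ d) {ι : Type*} (s : Finset ι) (hs : s.Nonempty)
    (b : ι → ℕ) (hb : ∀ i, 1 ≤ b i) :
    s.inf' hs (fun i => cStar k d (b i)) = cStar k d (s.inf' hs b) := by
  apply le_antisymm
  · obtain ⟨i, hi, h⟩ := s.exists_mem_eq_inf' hs b
    rw [h]
    exact Finset.inf'_le (fun i => cStar k d (b i)) hi
  · exact Finset.le_inf' _ _ fun i hi => cStar_mono hk hd
      (Finset.le_inf' _ _ fun i _ => hb i) (Finset.inf'_le b hi)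

end Constant

/-! ### Probabilistic formula for `V` and its consequences. -/

section Potential

variable {k d b : ℕ}

/-- Conditioning on the next trial reproduces the recursion for `V`: a success moves to `l + 1`, a
failure, `d - 1` times as likely, keeps `l`. Here `j` is the number of requests up to degree `k *
b`. -/
theorem V_eq_binE (hk : 1 ≤ k) (hd : 2 ≤ d) (hb : 1 ≤ b) (j : ℕ) :
    ∀ l δ, l ≤ b → δ + j = k * b →
      b * cStar k d b * (1 - V k d b l δ)
        = binE (1 / d) j (fun i => ((min b (l + i) : ℕ) : ℝ)) - l := by
  have hb0 : (0 : ℝ) < b := by exact_mod_cast hb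
  have hd0 : (0 : ℝ) < d := by positivity
  have hc := cStar_pos hk hd hb
  induction j with
  | zero =>
    intro l δ hl hδ
    rw [V_of_degree k d b l δ (by omega)]
    simp [binE, hl]
  | succ j ih =>
    intro l δ hl hδ
    rcases hl.lt_or_eq with hl | rfl
    · have h1 := ih (l + 1) (δ + 1) hl (by omega)
      have h2 := ih l (δ + 1) hl.le (by omega)
      have h3 := V_eq k d b l δ hd hl (by omega)
      rw [eq_div_iff (by positivity)] at h3
      simp only [Nat.add_right_comm l 1] at h1
      rw [binE]
      push_cast at h1 h2 ⊢
      field_simp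
      simp only [← add_assoc]
      simp only [one_div] at *
      linear_combination h1 + (d - 1) * h2 + h3
    · rw [V_full _ _ _ _ _ le_rfl]
      simp [binE_const]

theorem V_zero_zero (hk : 1 ≤ k) (hd : 2 ≤ d) (hb : 1 ≤ b) : V k d b 0 0 = 0 := by
  have h := V_eq_binE hk hd hb (k * b) 0 0 (Nat.zero_le _) (Nat.zero_add _)
  simp only [Nat.zero_add, ← mul_cStar hk hd hb, Nat.cast_zero, sub_zero] at h
  have hb0 : (0 : ℝ) < b := by exact_mod_cast hb
  have hc : (b : ℝ) * cStar k d b ≠ 0 := (mul_pos hb0 (cStar_pos hk hd hb)).ne'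
  have := mul_left_cancel₀ hc (h.trans (mul_one _).symm)
  linarith

/-- Subtracting the recursions at `δ` and `δ + 1` shows that the increment at (l, δ) is the average,
with weights 1/d and (d-1)/d, of the increments at (l+1, δ+1) and (l, δ+1). So nonnegativity
propagates down from `k * b`. -/
theorem V_le_succ (hk : 1 ≤ k) (hd : 2 ≤ d) (hb : 1 ≤ b) (l δ : ℕ) :
    V k d b l δ ≤ V k d b l (δ + 1) := by
  have hb0 : (0 : ℝ) < b := by exact_mod_cast hb
  have hd0 : (2 : ℝ) ≤ d := by exact_mod_cast hd
  have hc : 0 < 1 / ((b : ℝ) * cStar k d b) :=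
    one_div_pos.2 (mul_pos hb0 (cStar_pos hk hd hb))
  rcases le_or_gt (k * b) δ with hδ | hδ
  · rw [V_of_degree _ _ _ _ _ hδ, V_of_degree _ _ _ _ _ (by omega)]
  induction hj : k * b - δ generalizing l δ with
  | zero => omega
  | succ j ih =>
    rcases le_or_gt b l with hl | hl
    · rw [V_full _ _ _ _ _ hl, V_full _ _ _ _ _ hl]
    have h1 := V_eq k d b l δ hd hl hδ
    rcases le_or_gt (k * b) (δ + 1) with hδ' | hδ'
    · rw [V_of_degree _ _ _ _ _ hδ', V_of_degree _ _ _ _ _ hδ'] at h1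
      rw [V_of_degree _ _ _ _ _ hδ']
      by_contra! h
      have := mul_nonneg (by linarith : (0 : ℝ) ≤ d - 1)
        (by linarith : 0 ≤ V k d b l δ - 1)
      linarith
    · have h2 := V_eq k d b l (δ + 1) hd hl hδ'
      have h3 := ih (l + 1) (δ + 1) hδ' (by omega)
      have h4 := ih l (δ + 1) hδ' (by omega)
      by_contra! h
      have := mul_nonneg (by linarith : (0 : ℝ) ≤ d - 1) (sub_nonneg.2 h4)
      have := mul_nonneg (by linarith : (0 : ℝ) ≤ d - 1) (sub_nonneg.2 h.le)
      linarith

end Potential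

/-! ### Online runs, loads and degrees under extension of the input. -/

section Run

variable {S : Type*}

/-- Decisions on a prefix ignore later requests. This permits induction on the last request for both
loads and values. -/
theorem sum_run_concat {M : Type*} [AddCommMonoid M] (assign : List (Finset S) → Finset S → Option S)
    (g : Option S → M) (σ : List (Finset S)) (r : Finset S) :
    ∑ i, g (run assign (σ ++ [r]) i) = ∑ i, g (run assign σ i) + g (assign σ r) := by
  have hlen : (σ ++ [r]).length = σ.length + 1 := by simp
  rw [← (finCongr hlen.symm).sum_comp, Fin.sum_univ_castSucc]
  congr 1
  · refine Finset.sum_congr rfl fun i _ => ?_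
    simp [run, List.take_append_of_le_length i.2.le, List.getElem_append_left i.2]
  · simp [run]

theorem value_run_concat (assign : List (Finset S) → Finset S → Option S) (w : S → ℝ)
    (σ : List (Finset S)) (r : Finset S) :
    value w (run assign (σ ++ [r])) = value w (run assign σ) + (assign σ r).elim 0 w :=
  sum_run_concat assign (fun o => o.elim 0 w) σ r

variable [DecidableEq S]

theorem load_eq_sum {n : ℕ} (m : Fin n → Option S) (s : S) :
    load m s = ∑ i, if m i = some s then 1 else 0 := by
  rw [load, Finset.card_filter]

theorem load_run_concat (assign : List (Finset S) → Finset S → Option S)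
    (σ : List (Finset S)) (r : Finset S) (s : S) :
    load (run assign (σ ++ [r])) s
      = load (run assign σ) s + if assign σ r = some s then 1 else 0 := by
  simp only [load_eq_sum]
  exact sum_run_concat assign (fun o => if o = some s then 1 else 0) σ r

theorem load_run_nil (assign : List (Finset S) → Finset S → Option S) (s : S) :
    load (run assign []) s = 0 := by
  simp [load]

theorem value_eq_sum_load [Fintype S] (w : S → ℝ) {n : ℕ} (m : Fin n → Option S) :
    value w m = ∑ s, w s * load m s := by
  simp only [load_eq_sum, value, Nat.cast_sum, Finset.mul_sum]
  rw [Finset.sum_comm]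
  refine Finset.sum_congr rfl fun i _ => ?_
  cases m i <;> simp

theorem degree_append (σ τ : List (Finset S)) (s : S) :
    degree (σ ++ τ) s = degree σ s + degree τ s :=
  List.countP_append

theorem degree_singleton (r : Finset S) (s : S) :
    degree [r] s = if s ∈ r then 1 else 0 := by
  simp [degree, List.countP_singleton]

theorem degree_eq_zero (τ : List (Finset S)) (s : S) (h : ∀ r ∈ τ, s ∉ r) : degree τ s = 0 := by
  simpa [degree, List.countP_eq_zero] using h

theorem degree_eq_card (σ : List (Finset S)) (s : S) :
    degree σ s = (Finset.univ.filter fun i : Fin σ.length => s ∈ σ.get i).card := by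
  induction σ with
  | nil => simp [degree]
  | cons r σ ih =>
    rw [← List.singleton_append, degree_append, degree_singleton, ih, Finset.card_filter,
      Finset.card_filter]
    exact (Fin.sum_univ_succ (n := σ.length)
      fun i => if s ∈ (r :: σ).get i then 1 else 0).symm

variable {b : S → ℕ} (A : OnlineAlgorithm b)

theorem OnlineAlgorithm.mem_of_assign {σ : List (Finset S)} {r : Finset S} {s : S}
    (h : A.assign σ r = some s) : s ∈ r := by
  have := (A.isBMatching_run (σ ++ [r])).1 ⟨σ.length, by simp⟩ s (by simpa [run] using h)
  simpa using this

theorem OnlineAlgorithm.load_le (σ : List (Finset S)) (s : S) : load (run A.assign σ) s ≤ b s :=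
  (A.isBMatching_run σ).2 s

theorem OnlineAlgorithm.load_lt_of_assign {σ : List (Finset S)} {r : Finset S} {s : S}
    (h : A.assign σ r = some s) : load (run A.assign σ) s < b s := by
  have := A.load_le (σ ++ [r]) s
  rw [load_run_concat, if_pos h] at this
  exact this

/-- Requests not adjacent to `s` do not change its load. -/
theorem OnlineAlgorithm.load_append_of_notMem (σ τ : List (Finset S)) (s : S)
    (h : ∀ r ∈ τ, s ∉ r) : load (run A.assign (σ ++ τ)) s = load (run A.assign σ) s := by
  induction τ using List.reverseRecOn with
  | nil => rw [List.append_nil]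
  | append_singleton τ r ih =>
    rw [← List.append_assoc, load_run_concat, ih fun r hr => h r (by simp [hr]),
      if_neg fun e => h r (by simp) (A.mem_of_assign e), add_zero]

/-- The loads produced by a rule that sees the current loads, for requests listed from last to first. -/
def ruleLoads (pick : List (Finset S) → (S → ℕ) → Finset S → Option S) :
    List (Finset S) → S → ℕ
  | [], _ => 0
  | r :: ρ, s => ruleLoads pick ρ s
      + if pick ρ.reverse (ruleLoads pick ρ) r = some s then 1 else 0

/-- The online rule that determines its decision from the past and the loads so far. -/
def ruleAssign (pick : List (Finset S) → (S → ℕ) → Finset S → Option S)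
    (past : List (Finset S)) (r : Finset S) : Option S :=
  pick past (ruleLoads pick past.reverse) r

theorem load_ruleAssign (pick : List (Finset S) → (S → ℕ) → Finset S → Option S)
    (σ : List (Finset S)) : load (run (ruleAssign pick) σ) = ruleLoads pick σ.reverse := by
  induction σ using List.reverseRecOn with
  | nil => funext s; simp [load, ruleLoads]
  | append_singleton σ r ih =>
    funext s
    rw [load_run_concat, ih]
    simp only [List.reverse_append, List.reverse_singleton, List.singleton_append, ruleLoads,
      List.reverse_reverse, ruleAssign]
    congr

/-- A rule that respects adjacency and remaining capacity yields an online algorithm. -/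
def OnlineAlgorithm.ofRule (pick : List (Finset S) → (S → ℕ) → Finset S → Option S)
    (h : ∀ σ L r s, pick σ L r = some s → s ∈ r ∧ L s < b s) : OnlineAlgorithm b where
  assign := ruleAssign pick
  isBMatching_run σ := by
    refine ⟨fun i s hi => (h _ _ _ _ hi).1, fun s => ?_⟩
    induction σ using List.reverseRecOn with
    | nil => simp [load]
    | append_singleton σ r ih =>
      rw [load_run_concat]
      split_ifs with hs
      · have := (h _ _ _ _ hs).2
        rw [← load_ruleAssign] at this
        exact this
      · exact ih

end Run

/-! ### WeightedAssignment(VW): existence and competitive ratio. -/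

section Competitive

variable {S : Type*} [DecidableEq S]

/-- Priorities depend on the loads of the very algorithm being defined. To avoid circularity the
rule takes an arbitrary load vector, and `load_ruleAssign` identifies it with the actual loads. -/
theorem exists_isWeightedAssignmentVW (k d : ℕ) (b : S → ℕ) (w : S → ℝ) :
    ∃ A : OnlineAlgorithm b, IsWeightedAssignmentVW k d w A := by
  classical
  let prio : List (Finset S) → (S → ℕ) → S → ℝ := fun past L s =>
    w s * (b s : ℝ) * (V k d (b s) (L s) (degree past s + 1) - V k d (b s) (L s) (degree past s))
  let pick : List (Finset S) → (S → ℕ) → Finset S → Option S := fun past L r =>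
    if h : (r.filter fun s => L s < b s).Nonempty
      then some (Finset.exists_max_image _ (prio past L) h).choose else none
  have hpick : ∀ past L r (h : (r.filter fun s => L s < b s).Nonempty),
      ∃ s ∈ r.filter fun s => L s < b s, pick past L r = some s ∧
        ∀ s' ∈ r.filter fun s => L s < b s, prio past L s' ≤ prio past L s := by
    intro past L r h
    have := (Finset.exists_max_image _ (prio past L) h).choose_spec
    exact ⟨_, this.1, dif_pos h, this.2⟩
  refine ⟨OnlineAlgorithm.ofRule pick ?_, fun past r => ⟨fun h => ?_, fun h => ?_⟩⟩
  · intro past L r s hs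
    by_cases h : (r.filter fun s => L s < b s).Nonempty
    · obtain ⟨s', hs', e, -⟩ := hpick past L r h
      rw [e, Option.some_inj] at hs
      subst hs
      simpa using hs'
    · simp [pick, h] at hs
  · simp only [available, OnlineAlgorithm.ofRule, load_ruleAssign] at h
    simp only [OnlineAlgorithm.ofRule, ruleAssign, pick]
    rw [dif_neg]
    rw [h]
    simp
  · simp only [available, priority, OnlineAlgorithm.ofRule, load_ruleAssign] at h ⊢
    exact hpick _ _ _ h

variable {k d : ℕ} {b : S → ℕ} {w : S → ℝ} {A : OnlineAlgorithm b}

theorem priority_nonneg (hk : 1 ≤ k) (hd : 2 ≤ d) (hb : ∀ s, 1 ≤ b s) (hw : ∀ s, 0 ≤ w s)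
    (past : List (Finset S)) (s : S) : 0 ≤ priority k d w A past s :=
  mul_nonneg (mul_nonneg (hw s) (Nat.cast_nonneg _)) (sub_nonneg.2 (V_le_succ hk hd (hb s) _ _))

theorem priority_eq_zero_of_full {past : List (Finset S)} {s : S}
    (h : b s ≤ load (run A.assign past) s) : priority k d w A past s = 0 := by
  rw [priority, V_full _ _ _ _ _ h, V_full _ _ _ _ _ h, sub_self, mul_zero]

/-- The increase of the potential at a server that is not assigned the request. -/
theorem potential_term_of_ne (past : List (Finset S)) (r : Finset S) (s : S)
    (h : A.assign past r ≠ some s) :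
    w s * (b s : ℝ) * V k d (b s) (load (run A.assign (past ++ [r])) s) (degree (past ++ [r]) s)
      - w s * (b s : ℝ) * V k d (b s) (load (run A.assign past) s) (degree past s)
      = if s ∈ r then priority k d w A past s else 0 := by
  rw [load_run_concat, if_neg h, degree_append, degree_singleton, add_zero]
  split_ifs
  · rw [priority, mul_sub]
  · simp

/-- The increase of the potential at the server `s` that is assigned the request. -/
theorem potential_term_add_priority_le (hk : 1 ≤ k) (hd : 2 ≤ d) (hb : ∀ s, 1 ≤ b s)
    (hw : ∀ s, 0 ≤ w s) (past : List (Finset S)) (r : Finset S) (s : S)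
    (h : A.assign past r = some s) :
    w s * (b s : ℝ) * V k d (b s) (load (run A.assign (past ++ [r])) s) (degree (past ++ [r]) s)
      - w s * (b s : ℝ) * V k d (b s) (load (run A.assign past) s) (degree past s)
      + (d - 1) * priority k d w A past s ≤ w s / cStar k d (b s) := by
  have hb0 : (0 : ℝ) < b s := by exact_mod_cast hb s
  have hc := cStar_pos hk hd (hb s)
  rw [load_run_concat, if_pos h, degree_append, degree_singleton, if_pos (A.mem_of_assign h),
    priority]
  -- From degree `k * b s` on, `V` is constantly 1 and all increments vanish; before that, the bound
  -- is an equality given by the recursion.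
  rcases le_or_gt (k * b s) (degree past s) with hδ | hδ
  · rw [V_of_degree _ _ _ _ _ hδ, V_of_degree _ _ _ _ _ (by omega),
      V_of_degree _ _ _ _ _ (by omega)]
    simpa using div_nonneg (hw s) hc.le
  · have := V_eq k d (b s) _ _ hd (A.load_lt_of_assign h) hδ
    have e : w s / cStar k d (b s) = w s * b s * (1 / ((b s : ℝ) * cStar k d (b s))) := by
      field_simp
    rw [e, ← this]
    apply le_of_eq
    ring

variable [Fintype S]

/-- The potential used in the analysis of WeightedAssignment(VW). -/
noncomputable def potential (k d : ℕ) {b : S → ℕ} (w : S → ℝ) (A : OnlineAlgorithm b)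
    (σ : List (Finset S)) : ℝ :=
  ∑ s, w s * (b s : ℝ) * V k d (b s) (load (run A.assign σ) s) (degree σ s)

theorem potential_concat_sub_le (hk : 1 ≤ k) (hd : 2 ≤ d) (hb : ∀ s, 1 ≤ b s)
    (hw : ∀ s, 0 ≤ w s) (hA : IsWeightedAssignmentVW k d w A) (past : List (Finset S))
    (r : Finset S) (hr : r.card ≤ d) :
    potential k d w A (past ++ [r]) - potential k d w A past
      ≤ (A.assign past r).elim 0 fun s => w s / cStar k d (b s) := by
  rw [potential, potential, ← Finset.sum_sub_distrib]
  rcases (available A past r).eq_empty_or_nonempty with h | h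
  · have hnone := (hA past r).1 h
    rw [hnone]
    refine Finset.sum_nonpos fun s _ => ?_
    rw [potential_term_of_ne _ _ _ (by simp [hnone])]
    split_ifs with hs
    · apply le_of_eq
      apply priority_eq_zero_of_full
      by_contra! hlt
      exact Finset.notMem_empty s (h ▸ Finset.mem_filter.2 ⟨hs, hlt⟩)
    · exact le_rfl
  · obtain ⟨s, hs, e, hmax⟩ := (hA past r).2 h
    have hsr : s ∈ r := A.mem_of_assign e
    rw [e, ← Finset.add_sum_erase _ _ (Finset.mem_univ s)]
    refine le_trans ?_ (potential_term_add_priority_le hk hd hb hw past r s e)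
    gcongr
    calc _ = ∑ s' ∈ Finset.univ.erase s, if s' ∈ r then priority k d w A past s' else 0 :=
          Finset.sum_congr rfl fun s' hs' => potential_term_of_ne _ _ _ fun e' =>
            (Finset.mem_erase.1 hs').1 (Option.some_inj.1 (e'.symm.trans e))
      _ = ∑ s' ∈ r.erase s, priority k d w A past s' := by
          rw [← Finset.sum_filter]
          congr 1
          ext s'
          simp [and_comm]
      _ ≤ ∑ s' ∈ r.erase s, priority k d w A past s := by
          refine Finset.sum_le_sum fun s' hs' => ?_
          -- The greedy choice compares available servers only; full neighbours have priority 0.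
          rcases lt_or_ge (load (run A.assign past) s') (b s') with hlt | hge
          · exact hmax s' (Finset.mem_filter.2 ⟨Finset.mem_of_mem_erase hs', hlt⟩)
          · rw [priority_eq_zero_of_full hge]
            exact priority_nonneg hk hd hb hw past s
      _ ≤ (d - 1) * priority k d w A past s := by
          rw [Finset.sum_const, nsmul_eq_mul, Finset.card_erase_of_mem hsr]
          refine mul_le_mul_of_nonneg_right ?_ (priority_nonneg hk hd hb hw past s)
          rw [← Nat.cast_pred (by omega : 0 < d)]
          exact_mod_cast Nat.sub_le_sub_right hr 1

theorem potential_nil (hk : 1 ≤ k) (hd : 2 ≤ d) (hb : ∀ s, 1 ≤ b s) :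
    potential k d w A [] = 0 := by
  refine Finset.sum_eq_zero fun s _ => ?_
  rw [load_run_nil]
  change _ * V k d (b s) 0 0 = 0
  rw [V_zero_zero hk hd (hb s), mul_zero]

theorem mul_potential_le_value (hk : 1 ≤ k) (hd : 2 ≤ d) (hb : ∀ s, 1 ≤ b s)
    (hw : ∀ s, 0 ≤ w s) (hA : IsWeightedAssignmentVW k d w A) {c : ℝ} (hc0 : 0 ≤ c)
    (hc : ∀ s, c ≤ cStar k d (b s)) (σ : List (Finset S)) (hσ : ∀ r ∈ σ, r.card ≤ d) :
    c * potential k d w A σ ≤ value w (run A.assign σ) := by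
  induction σ using List.reverseRecOn with
  | nil => simp [potential_nil hk hd hb, value]
  | append_singleton σ r ih =>
    have h1 := ih fun r hr => hσ r (by simp [hr])
    have h2 := potential_concat_sub_le hk hd hb hw hA σ r (hσ r (by simp))
    rw [value_run_concat]
    have h3 := mul_le_mul_of_nonneg_left h2 hc0
    have h4 : c * ((A.assign σ r).elim 0 fun s => w s / cStar k d (b s))
        ≤ (A.assign σ r).elim 0 w := by
      cases A.assign σ r with
      | none => simp
      | some s =>
        change c * (w s / _) ≤ w s
        have hs := cStar_pos hk hd (hb s)
        rw [mul_div_assoc', div_le_iff₀ hs, mul_comm]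
        exact mul_le_mul_of_nonneg_left (hc s) (hw s)
    linarith

theorem opt_le_sum (hw : ∀ s, 0 ≤ w s) (σ : List (Finset S)) : opt b w σ ≤ ∑ s, w s * b s := by
  obtain ⟨m, hm, e⟩ := (isGreatest_opt b w σ).1
  rw [← e, value_eq_sum_load]
  exact Finset.sum_le_sum fun s _ =>
    mul_le_mul_of_nonneg_left (by exact_mod_cast hm.2 s) (hw s)

/-- The lower bound on the degrees enters only here: it makes every `V` equal to 1 at the end. -/
theorem IsWeightedAssignmentVW.isCompetitive (hk : 1 ≤ k) (hd : 2 ≤ d) (hb : ∀ s, 1 ≤ b s)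
    (hw : ∀ s, 0 ≤ w s) (hA : IsWeightedAssignmentVW k d w A) {c : ℝ} (hc0 : 0 ≤ c)
    (hc : ∀ s, c ≤ cStar k d (b s)) : IsCompetitive k d w A c := by
  intro σ hσ
  refine le_trans (mul_le_mul_of_nonneg_left ?_ hc0)
    (mul_potential_le_value hk hd hb hw hA hc0 hc σ hσ.2)
  refine (opt_le_sum hw σ).trans (le_of_eq (Finset.sum_congr rfl fun s _ => ?_))
  rw [V_of_degree _ _ _ _ _ (hσ.1 s), mul_one]

end Competitive

/-! ### The optimum for `d ≤ k`, by Hall's theorem. -/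

section Opt

variable {S : Type*} [DecidableEq S] {k d : ℕ} {b : S → ℕ}

/-- For `d ≤ k`, every `(k,d)`-graph has a `b`-matching that saturates all servers. -/
theorem exists_saturating (hd : 1 ≤ d) (hkd : d ≤ k) (σ : List (Finset S))
    (hσ : IsKDGraph k d b σ) :
    ∃ m : Fin σ.length → Option S, IsBMatching b σ m ∧ ∀ s, load m s = b s := by
  classical
  let t : (Σ s, Fin (b s)) → Finset (Fin σ.length) := fun x =>
    Finset.univ.filter fun i => x.1 ∈ σ.get i
  -- Hall's condition for `b s` copies of each server, by double counting edges: d|X| is at most the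
  -- degree sum of the servers involved, which is at most d|N(X)|.
  have hall : ∀ X : Finset (Σ s, Fin (b s)), X.card ≤ (X.biUnion t).card := by
    intro X
    let Y := X.image Sigma.fst
    have h1 : X.card ≤ ∑ s ∈ Y, b s := by
      have : X ⊆ Y.sigma fun s => (Finset.univ : Finset (Fin (b s))) := fun x hx =>
        Finset.mem_sigma.2 ⟨Finset.mem_image_of_mem _ hx, Finset.mem_univ _⟩
      simpa using Finset.card_le_card this
    have h2 : ∑ s ∈ Y, degree σ s ≤ ∑ i ∈ X.biUnion t, (σ.get i).card := by
      have e : ∀ s ∈ Y, degree σ s = ∑ i ∈ X.biUnion t, if s ∈ σ.get i then 1 else 0 := by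
        intro s hs
        rw [degree_eq_card, ← Finset.card_filter]
        congr 1
        ext i
        simp only [Finset.mem_filter, Finset.mem_univ, true_and, Finset.mem_biUnion]
        refine ⟨fun h => ⟨?_, h⟩, fun h => h.2⟩
        obtain ⟨x, hx, rfl⟩ := Finset.mem_image.1 hs
        exact ⟨x, hx, Finset.mem_filter.2 ⟨Finset.mem_univ _, h⟩⟩
      rw [Finset.sum_congr rfl e, Finset.sum_comm]
      refine Finset.sum_le_sum fun i _ => ?_
      rw [← Finset.card_filter]
      exact Finset.card_le_card fun s hs => (Finset.mem_filter.1 hs).2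
    have h3 : ∑ i ∈ X.biUnion t, (σ.get i).card ≤ (X.biUnion t).card * d :=
      Finset.sum_le_card_nsmul _ _ _ fun i _ => hσ.2 _ (σ.get_mem i)
    have h4 : d * ∑ s ∈ Y, b s ≤ ∑ s ∈ Y, degree σ s := by
      rw [Finset.mul_sum]
      exact Finset.sum_le_sum fun s _ => (Nat.mul_le_mul_right _ hkd).trans (hσ.1 s)
    refine Nat.le_of_mul_le_mul_left ?_ hd
    calc d * X.card ≤ d * ∑ s ∈ Y, b s := Nat.mul_le_mul_left _ h1
      _ ≤ (X.biUnion t).card * d := h4.trans (h2.trans h3)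
      _ = _ := mul_comm _ _
  obtain ⟨f, hf, hft⟩ := (Finset.all_card_le_biUnion_card_iff_exists_injective t).1 hall
  let m : Fin σ.length → Option S := fun i => (Function.partialInv f i).map Sigma.fst
  have hm : ∀ i s, m i = some s ↔ ∃ j : Fin (b s), f ⟨s, j⟩ = i := by
    intro i s
    simp only [m, Option.map_eq_some_iff]
    constructor
    · rintro ⟨⟨s, j⟩, h, rfl⟩
      exact ⟨j, (hf.isPartialInv _ _).1 h⟩
    · rintro ⟨j, h⟩
      exact ⟨⟨s, j⟩, (hf.isPartialInv _ _).2 h, rfl⟩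
  have hload : ∀ s, load m s = b s := by
    intro s
    have : (Finset.univ.filter fun i => m i = some s)
        = (Finset.univ : Finset (Fin (b s))).image (f ∘ Sigma.mk s) := by
      ext i
      simp [hm]
    rw [load, this, Finset.card_image_of_injective _ (hf.comp sigma_mk_injective)]
    simp
  refine ⟨m, ⟨fun i s h => ?_, fun s => (hload s).le⟩, hload⟩
  obtain ⟨j, rfl⟩ := (hm i s).1 h
  exact (Finset.mem_filter.1 (hft ⟨s, j⟩)).2

theorem sum_le_opt [Fintype S] (hd : 1 ≤ d) (hkd : d ≤ k) (w : S → ℝ) (σ : List (Finset S))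
    (hσ : IsKDGraph k d b σ) : ∑ s, w s * b s ≤ opt b w σ := by
  obtain ⟨m, hm, hload⟩ := exists_saturating hd hkd σ hσ
  refine (isGreatest_opt b w σ).2 ⟨m, hm, ?_⟩
  rw [value_eq_sum_load]
  exact Finset.sum_congr rfl fun s _ => by rw [hload]

end Opt

/-! ### The adversary on servers of equal capacity. -/

section Adversary

variable {S : Type*} [DecidableEq S] {b : S → ℕ} (A : OnlineAlgorithm b)

/-- One round of the adversary: the servers of `U` are split into groups of size `d`, each of which
forms a request, so that the load increases for at most one server of each group. -/
theorem exists_round (d : ℕ) (hd : 1 ≤ d) (l q : ℕ) (U : Finset S) (hU : U.card = q * d)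
    (σ : List (Finset S)) (hl : ∀ s ∈ U, load (run A.assign σ) s ≤ l) :
    ∃ (τ : List (Finset S)) (W : Finset S), (∀ r ∈ τ, r ⊆ U ∧ r.card = d) ∧
      (∀ s ∈ U, degree τ s = 1) ∧ W ⊆ U ∧ W.card = q ∧
      (∀ s ∈ W, load (run A.assign (σ ++ τ)) s ≤ l + 1) ∧
      ∀ s ∈ U \ W, load (run A.assign (σ ++ τ)) s ≤ l := by
  induction q generalizing U σ with
  | zero =>
    have : U = ∅ := by simpa using hU
    subst this
    exact ⟨[], ∅, by simp, by simp, by simp, by simp, by simp, by simp⟩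
  | succ q ih =>
    obtain ⟨r, hrU, hr⟩ := Finset.exists_subset_card_eq (n := d) (s := U)
      (by rw [hU]; exact Nat.le_mul_of_pos_left d q.succ_pos)
    -- The server that receives `r`, or an arbitrary member if `r` stays unmatched, so that `W` has
    -- exactly one server per group.
    obtain ⟨s₀, hs₀, hs₀'⟩ : ∃ s₀ ∈ r, ∀ s ∈ r, s ≠ s₀ → A.assign σ r ≠ some s := by
      cases h : A.assign σ r with
      | none =>
        obtain ⟨s, hs⟩ := Finset.card_pos.1 (hr.symm ▸ hd : 0 < r.card)
        exact ⟨s, hs, by simp⟩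
      | some s =>
        exact ⟨s, A.mem_of_assign h, fun s' _ hne e => hne (Option.some_inj.1 e).symm⟩
    have hcard : (U \ r).card = q * d := by
      rw [Finset.card_sdiff_of_subset hrU, hU, hr, Nat.succ_mul, Nat.add_sub_cancel]
    obtain ⟨τ, W, hτ, hdeg, hWU, hW, hlW, hlL⟩ := ih (U \ r) hcard (σ ++ [r]) (by
      intro s hs
      obtain ⟨hsU, hsr⟩ := Finset.mem_sdiff.1 hs
      rw [A.load_append_of_notMem σ [r] s (by simpa using hsr)]
      exact hl s hsU)
    have hτr : ∀ s ∈ r, ∀ r' ∈ τ, s ∉ r' := fun s hs r' hr' h =>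
      (Finset.mem_sdiff.1 ((hτ r' hr').1 h)).2 hs
    have hloadr : ∀ s ∈ r, load (run A.assign (σ ++ r :: τ)) s
        = load (run A.assign σ) s + if A.assign σ r = some s then 1 else 0 := by
      intro s hs
      rw [List.append_cons, A.load_append_of_notMem _ _ _ (hτr s hs), load_run_concat]
    have hs₀W : s₀ ∉ W := fun h => (Finset.mem_sdiff.1 (hWU h)).2 hs₀
    refine ⟨r :: τ, insert s₀ W, ?_, ?_, ?_, ?_, ?_, ?_⟩
    · intro r' hr'
      rcases List.mem_cons.1 hr' with rfl | hr'
      · exact ⟨hrU, hr⟩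
      · exact ⟨(hτ r' hr').1.trans Finset.sdiff_subset, (hτ r' hr').2⟩
    · intro s hs
      rw [← List.singleton_append, degree_append, degree_singleton]
      by_cases hsr : s ∈ r
      · rw [if_pos hsr, degree_eq_zero _ _ (hτr s hsr)]
      · rw [if_neg hsr, hdeg s (Finset.mem_sdiff.2 ⟨hs, hsr⟩)]
    · exact Finset.insert_subset (hrU hs₀) (hWU.trans Finset.sdiff_subset)
    · rw [Finset.card_insert_of_notMem hs₀W, hW]
    · intro s hs
      rcases Finset.mem_insert.1 hs with rfl | hs
      · rw [hloadr s hs₀]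
        have := hl s (hrU hs₀)
        split_ifs <;> omega
      · rw [List.append_cons]
        exact hlW s hs
    · intro s hs
      simp only [Finset.mem_sdiff, Finset.mem_insert, not_or] at hs
      obtain ⟨hsU, hne, hsW⟩ := hs
      by_cases hsr : s ∈ r
      · rw [hloadr s hsr, if_neg (hs₀' s hsr hne), add_zero]
        exact hl s hsU
      · rw [List.append_cons]
        exact hlL s (Finset.mem_sdiff.2 ⟨Finset.mem_sdiff.2 ⟨hsU, hsr⟩, hsW⟩)

/-- The adversary forces the loads of the servers in `U`, all of capacity `β`, to be at most
distributed as under independent random assignments. -/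
theorem exists_adversary (d : ℕ) (hd : 1 ≤ d) (β : ℕ) (j : ℕ) (l q : ℕ) (U : Finset S)
    (hU : U.card = q * d ^ j) (hb : ∀ s ∈ U, b s = β)
    (σ : List (Finset S)) (hl : ∀ s ∈ U, load (run A.assign σ) s ≤ l) :
    ∃ τ : List (Finset S), (∀ r ∈ τ, r ⊆ U ∧ r.card = d) ∧ (∀ s ∈ U, degree τ s = j) ∧
      ((∑ s ∈ U, load (run A.assign (σ ++ τ)) s : ℕ) : ℝ)
        ≤ q * d ^ j * binE (1 / d) j (fun i => ((min β (l + i) : ℕ) : ℝ)) := by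
  induction j generalizing l q U σ with
  | zero =>
    refine ⟨[], by simp, by simp [degree], ?_⟩
    have h : ∑ s ∈ U, load (run A.assign (σ ++ [])) s ≤ U.card * min β l :=
      Finset.sum_le_card_nsmul _ _ _ fun s hs => by
        rw [List.append_nil]
        exact le_min (hb s hs ▸ A.load_le σ s) (hl s hs)
    rw [hU] at h
    have h' : ((∑ s ∈ U, load (run A.assign (σ ++ [])) s : ℕ) : ℝ)
      ≤ ((q * d ^ 0 * min β l : ℕ) : ℝ) := Nat.cast_le.2 h
    simpa [binE] using h'
  | succ j ih =>
    obtain ⟨τ₀, W, hτ₀, hdeg₀, hWU, hW, hlW, hlL⟩ :=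
      exists_round A d hd l (q * d ^ j) U (by rw [hU, pow_succ, mul_assoc]) σ hl
    have hL : (U \ W).card = (d - 1) * q * d ^ j := by
      rw [Finset.card_sdiff_of_subset hWU, hW, hU, pow_succ]
      obtain ⟨e, rfl⟩ : ∃ e, d = e + 1 := ⟨d - 1, by omega⟩
      rw [Nat.add_sub_cancel]
      apply Nat.sub_eq_of_eq_add
      ring
    -- `W`, a fraction 1/d of `U`, plays the role of a success and continues with bound `l + 1`; the
    -- rest continues with `l`. The two continuations use disjoint servers, so they can run one
    -- after the other.
    obtain ⟨τ₁, hτ₁, hdeg₁, hsum₁⟩ := ih (l + 1) q W hW (fun s hs => hb s (hWU hs)) (σ ++ τ₀) hlW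
    have hnot₁ : ∀ s ∈ U \ W, ∀ r ∈ τ₁, s ∉ r := fun s hs r hr h =>
      (Finset.mem_sdiff.1 hs).2 ((hτ₁ r hr).1 h)
    obtain ⟨τ₂, hτ₂, hdeg₂, hsum₂⟩ := ih l ((d - 1) * q) (U \ W) hL
      (fun s hs => hb s (Finset.mem_sdiff.1 hs).1) (σ ++ τ₀ ++ τ₁) (fun s hs => by
        rw [A.load_append_of_notMem _ _ _ (hnot₁ s hs)]
        exact hlL s hs)
    have hnot₂ : ∀ s ∈ W, ∀ r ∈ τ₂, s ∉ r := fun s hs r hr h =>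
      (Finset.mem_sdiff.1 ((hτ₂ r hr).1 h)).2 hs
    refine ⟨τ₀ ++ τ₁ ++ τ₂, ?_, ?_, ?_⟩
    · intro r hr
      simp only [List.mem_append] at hr
      rcases hr with (hr | hr) | hr
      · exact hτ₀ r hr
      · exact ⟨(hτ₁ r hr).1.trans hWU, (hτ₁ r hr).2⟩
      · exact ⟨(hτ₂ r hr).1.trans Finset.sdiff_subset, (hτ₂ r hr).2⟩
    · intro s hs
      rw [degree_append, degree_append, hdeg₀ s hs]
      by_cases hsW : s ∈ W
      · rw [hdeg₁ s hsW, degree_eq_zero _ _ (hnot₂ s hsW)]; ring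
      · have hs' := Finset.mem_sdiff.2 ⟨hs, hsW⟩
        rw [hdeg₂ s hs', degree_eq_zero _ _ (hnot₁ s hs')]; ring
    · have e₁ : ∑ s ∈ W, load (run A.assign (σ ++ (τ₀ ++ τ₁ ++ τ₂))) s
          = ∑ s ∈ W, load (run A.assign (σ ++ τ₀ ++ τ₁)) s :=
        Finset.sum_congr rfl fun s hs => by
          rw [← List.append_assoc, ← List.append_assoc, A.load_append_of_notMem _ _ _ (hnot₂ s hs)]
      have hd0 : (d : ℝ) ≠ 0 := by positivity
      rw [← Finset.sum_sdiff hWU, e₁, ← List.append_assoc, ← List.append_assoc, Nat.cast_add, binE]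
      simp only [Nat.add_right_comm l 1] at hsum₁
      simp only [← add_assoc]
      refine (add_le_add hsum₂ hsum₁).trans (le_of_eq ?_)
      push_cast [Nat.cast_pred hd]
      field_simp
      ring

end Adversary

/-! ### Upper bound on the ratio of every deterministic algorithm. -/

section Optimality

variable {k d : ℕ}

theorem degree_flatMap_replicate {S : Type*} [DecidableEq S] (T : List S) (n : S → ℕ) (s : S) :
    degree (T.flatMap fun t => List.replicate (n t) ({t} : Finset S)) s = T.count s * n s := by
  induction T with
  | nil => simp [degree]
  | cons t T ih =>
    rw [List.flatMap_cons, degree_append, ih, List.count_cons]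
    by_cases h : t = s
    · subst h
      simp [degree, List.countP_replicate, Nat.add_mul, Nat.add_comm]
    · simp [degree, List.countP_replicate, h, Ne.symm h]

/-- On servers of which all but those in `R` have the same capacity `β` and weight `ω`, an online
algorithm is not much better than `cStar k d β`. -/
theorem IsCompetitive.mul_le {S : Type*} [Fintype S] [DecidableEq S] {b : S → ℕ} {w : S → ℝ}
    {A : OnlineAlgorithm b} (hk : 1 ≤ k) (hd : 2 ≤ d) (hkd : d ≤ k) {c : ℝ} (hc0 : 0 ≤ c)
    (hA : IsCompetitive k d w A c) (hw : ∀ s, 0 ≤ w s) {β : ℕ} (hβ : 1 ≤ β) {ω : ℝ}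
    (U : Finset S) (q : ℕ) (hU : U.card = q * d ^ (k * β)) (hb : ∀ s ∈ U, b s = β)
    (hω : ∀ s ∈ U, w s = ω) :
    c * (U.card * ω * β) ≤ U.card * ω * β * cStar k d β + ∑ s ∈ Uᶜ, w s * b s := by
  obtain ⟨τ, hτ, hdeg, hsum⟩ := exists_adversary A d (by omega) β (k * β) 0 q U hU hb []
    (fun s _ => by rw [load_run_nil])
  rw [List.nil_append] at hsum
  -- Singleton requests give the servers outside `U` their required degree without touching `U`.
  set ρ := Uᶜ.toList.flatMap fun t => List.replicate (k * b t) ({t} : Finset S) with hρ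
  have hmem : ∀ r ∈ ρ, ∃ t, t ∉ U ∧ r = {t} := by
    intro r hr
    obtain ⟨t, ht, h⟩ := List.mem_flatMap.1 hr
    exact ⟨t, by simpa using ht, (List.mem_replicate.1 h).2⟩
  have hKD : IsKDGraph k d b (τ ++ ρ) := by
    refine ⟨fun s => ?_, fun r hr => ?_⟩
    · rw [degree_append]
      by_cases hs : s ∈ U
      · rw [hdeg s hs, hb s hs]
        exact Nat.le_add_right _ _
      · rw [hρ, degree_flatMap_replicate, List.count_eq_one_of_mem (Finset.nodup_toList _)
          (by simpa using hs), one_mul]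
        exact Nat.le_add_left _ _
    · rcases List.mem_append.1 hr with hr | hr
      · exact (hτ r hr).2.le
      · obtain ⟨t, -, rfl⟩ := hmem r hr
        rw [Finset.card_singleton]
        omega
  have hcomp := hA _ hKD
  have hopt := sum_le_opt (by omega) hkd w _ hKD
  have hlow : U.card * ω * β ≤ ∑ s, w s * (b s : ℝ) := by
    rw [← Finset.sum_add_sum_compl U]
    have h1 : ∑ s ∈ U, w s * (b s : ℝ) = U.card * ω * β := by
      rw [Finset.sum_congr rfl fun s hs => by rw [hb s hs, hω s hs], Finset.sum_const,
        nsmul_eq_mul, mul_assoc]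
    have h2 : 0 ≤ ∑ s ∈ Uᶜ, w s * (b s : ℝ) :=
      Finset.sum_nonneg fun s _ => mul_nonneg (hw s) (Nat.cast_nonneg _)
    linarith
  have hup : value w (run A.assign (τ ++ ρ))
      ≤ U.card * ω * β * cStar k d β + ∑ s ∈ Uᶜ, w s * (b s : ℝ) := by
    rw [value_eq_sum_load, ← Finset.sum_add_sum_compl U]
    refine add_le_add ?_ (Finset.sum_le_sum fun s _ => mul_le_mul_of_nonneg_left
      (by exact_mod_cast A.load_le _ s) (hw s))
    rcases U.eq_empty_or_nonempty with rfl | ⟨s₁, hs₁⟩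
    · simp
    have hω0 : 0 ≤ ω := hω s₁ hs₁ ▸ hw s₁
    have e : ∑ s ∈ U, w s * (load (run A.assign (τ ++ ρ)) s : ℝ)
        = ω * ((∑ s ∈ U, load (run A.assign τ) s : ℕ) : ℝ) := by
      rw [Nat.cast_sum, Finset.mul_sum]
      refine Finset.sum_congr rfl fun s hs => ?_
      rw [hω s hs, A.load_append_of_notMem]
      intro r hr h
      obtain ⟨t, ht, rfl⟩ := hmem r hr
      exact ht (Finset.mem_singleton.1 h ▸ hs)
    simp only [Nat.zero_add] at hsum
    rw [← mul_cStar hk hd hβ] at hsum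
    rw [e, hU]
    refine (mul_le_mul_of_nonneg_left hsum hω0).trans (le_of_eq ?_)
    push_cast
    ring
  exact (mul_le_mul_of_nonneg_left (hlow.trans hopt) hc0).trans (hcomp.trans hup)

theorem le_cStar_of_forall_isCompetitive (hk : 1 ≤ k) (hd : 2 ≤ d) (hkd : d ≤ k)
    (T : Finset (ℕ × ℝ)) (hT : ∀ t ∈ T, 1 ≤ t.1 ∧ 0 < t.2) {t₀ : ℕ × ℝ} (ht₀ : t₀ ∈ T)
    (A : ∀ (n : ℕ) (b : Fin n → ℕ), (Fin n → ℝ) → OnlineAlgorithm b) (c : ℝ)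
    (hA : ∀ (n : ℕ) (b : Fin n → ℕ) (w : Fin n → ℝ),
      Set.range (fun s => (b s, w s)) = (T : Set (ℕ × ℝ)) → IsCompetitive k d w (A n b w) c) :
    c ≤ cStar k d t₀.1 := by
  classical
  obtain ⟨hβ, hω⟩ := hT t₀ ht₀
  have hcs := cStar_pos hk hd hβ
  rcases lt_or_ge c 0 with hc0 | hc0
  · exact hc0.le.trans hcs.le
  set D := d ^ (k * t₀.1)
  have hD : 1 ≤ D := Nat.one_le_pow _ _ (by omega)
  set C := ∑ t ∈ T, t.2 * (t.1 : ℝ)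
  -- Any excess of `c` over the constant is multiplied by `q`, whereas the other servers contribute
  -- a fixed `C`; the Archimedean property then forces the excess to be nonpositive.
  have key : ∀ q : ℕ, q * ((c - cStar k d t₀.1) * (D * t₀.2 * t₀.1)) ≤ C := by
    intro q
    -- `q * D` copies of `t₀` for the adversary, plus one server for each pair in `T`, so that
    -- exactly `T` occurs even when `q = 0`.
    let ι := Fin (q * D) ⊕ T
    let e : Fin (Fintype.card ι) ≃ ι := (Fintype.equivFin ι).symm
    let p : ι → ℕ × ℝ := Sum.elim (fun _ => t₀) Subtype.val
    have hp : ∀ i, p i ∈ T := by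
      rintro (i | i)
      · exact ht₀
      · exact i.2
    have hrange : Set.range (fun s => ((p (e s)).1, (p (e s)).2)) = (T : Set (ℕ × ℝ)) := by
      ext t
      refine ⟨fun ⟨s, hs⟩ => hs ▸ hp (e s), fun ht => ⟨e.symm (Sum.inr ⟨t, ht⟩), ?_⟩⟩
      simp [p]
    let U : Finset (Fin (Fintype.card ι)) :=
      Finset.univ.filter fun s => (e s).isLeft
    have hpU : ∀ s ∈ U, p (e s) = t₀ := by
      intro s hs
      obtain ⟨i, hi⟩ := Sum.isLeft_iff.1 (Finset.mem_filter.1 hs).2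
      rw [hi]
      rfl
    have hsumι : ∀ g : ι → ℝ, ∑ s, g (e s) = ∑ i, g (Sum.inl i) + ∑ t, g (Sum.inr t) := by
      intro g
      rw [e.sum_comp g, Fintype.sum_sum_type]
    have hUcard : U.card = q * D := by
      have := hsumι fun i => if i.isLeft then 1 else 0
      rw [← Finset.sum_filter] at this
      have h2 : (U.card : ℝ) = (q * D : ℕ) := by
        rw [Finset.card_eq_sum_ones, Nat.cast_sum]
        simpa only [Nat.cast_one, Sum.isLeft_inl, Sum.isLeft_inr, if_true, Bool.false_eq_true,
          if_false, Finset.sum_const_zero, add_zero, Finset.sum_const, nsmul_eq_mul, mul_one,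
          Finset.card_univ, Fintype.card_fin] using this
      exact_mod_cast h2
    have hUc : ∑ s ∈ Uᶜ, (p (e s)).2 * ((p (e s)).1 : ℝ) = C := by
      have := hsumι fun i => if i.isLeft then 0 else (p i).2 * ((p i).1 : ℝ)
      rw [Finset.compl_filter, Finset.sum_filter]
      simp only [ite_not, this, Sum.isLeft_inl, Sum.isLeft_inr, if_true, Finset.sum_const_zero,
        zero_add]
      simpa [p, C] using Finset.sum_coe_sort T fun t => t.2 * (t.1 : ℝ)
    have h := (hA _ (fun s => (p (e s)).1) (fun s => (p (e s)).2) hrange).mul_le hk hd hkd hc0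
      (fun s => (hT _ (hp _)).2.le) hβ U q hUcard (fun s hs => by rw [hpU s hs])
      (fun s hs => by rw [hpU s hs])
    rw [hUc, hUcard] at h
    push_cast at h
    linarith
  by_contra! hlt
  have hpos : 0 < (c - cStar k d t₀.1) * (D * t₀.2 * t₀.1) := by
    have h1 : (0 : ℝ) < D := by exact_mod_cast hD
    have h2 : (0 : ℝ) < t₀.1 := by exact_mod_cast hβ
    exact mul_pos (sub_pos.2 hlt) (mul_pos (mul_pos h1 hω) h2)
  obtain ⟨q, hq⟩ := exists_lt_nsmul hpos C
  rw [nsmul_eq_mul] at hq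
  exact absurd (key q) (not_le.2 hq)

end Optimality

end OnlineBMatching

theorem mainTheorem5 (k d : ℕ) (hk : 1 ≤ k) (hd : 2 ≤ d) :
    -- WeightedAssignment(VW) exists and is `min_s c*_s`-competitive, however ties are broken
    (∀ (n : ℕ) [NeZero n] (b : Fin n → ℕ) (w : Fin n → ℝ), (∀ s, 1 ≤ b s) → (∀ s, 0 ≤ w s) →
      (∃ A : OnlineBMatching.OnlineAlgorithm b, OnlineBMatching.IsWeightedAssignmentVW k d w A) ∧
      ∀ A : OnlineBMatching.OnlineAlgorithm b, OnlineBMatching.IsWeightedAssignmentVW k d w A →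
        OnlineBMatching.IsCompetitive k d w A
          (Finset.univ.inf' Finset.univ_nonempty
            (fun s => OnlineBMatching.cStar k d (b s)))) ∧
    -- for `k ≥ d` this ratio is `c*` for the smallest capacity
    (d ≤ k → ∀ (n : ℕ) [NeZero n] (b : Fin n → ℕ), (∀ s, 1 ≤ b s) →
      Finset.univ.inf' Finset.univ_nonempty (fun s => OnlineBMatching.cStar k d (b s))
        = OnlineBMatching.cStar k d (Finset.univ.inf' Finset.univ_nonempty b)) ∧
    -- for `k ≥ d` no deterministic online algorithm has a larger ratio, for any prescribed
    -- finite set `T` of pairs (capacity, weight) of the servers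
    (d ≤ k → ∀ (T : Finset (ℕ × ℝ)) (hT : T.Nonempty), (∀ t ∈ T, 1 ≤ t.1 ∧ 0 < t.2) →
      ∀ (A : ∀ (n : ℕ) (b : Fin n → ℕ), (Fin n → ℝ) → OnlineBMatching.OnlineAlgorithm b) (c : ℝ),
        (∀ (n : ℕ) (b : Fin n → ℕ) (w : Fin n → ℝ),
          Set.range (fun s => (b s, w s)) = (T : Set (ℕ × ℝ)) →
          OnlineBMatching.IsCompetitive k d w (A n b w) c) →
        c ≤ OnlineBMatching.cStar k d (T.inf' hT Prod.fst)) := by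
  refine ⟨fun n _ b w hb hw => ⟨OnlineBMatching.exists_isWeightedAssignmentVW k d b w,
    fun A hA => hA.isCompetitive hk hd hb hw ?_ fun s => Finset.inf'_le _ (Finset.mem_univ s)⟩,
    fun _ n _ b hb => OnlineBMatching.inf'_cStar hk hd _ _ b hb, fun hkd T hT hT' A c hA => ?_⟩
  · exact Finset.le_inf' _ _ fun s _ => (OnlineBMatching.cStar_pos hk hd (hb s)).le
  · obtain ⟨t, ht, e⟩ := T.exists_mem_eq_inf' hT Prod.fst
    rw [e]
    exact OnlineBMatching.le_cStar_of_forall_isCompetitive hk hd hkd T hT' ht A c hA
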